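/- For $\mu,r\in\mathbb{C}$ let $A_0(\mu,r)=1$ and $A_t(\mu,r)=\frac{r}{t!}\prod_{j=1}^{t-1}(t\mu+r-j)$ for $t\ge 1$ be the Fuss–Catalan numbers, and let $\mathcal{B}(\mu;r;z)=\sum_{t\ge 0}A_t(\mu,r)z^t$ be the associated Fuss–Catalan series; convergence of such a series means absolute convergence. Let $\gamma\in\mathbb{C}$ and consider the Bring–Jerrard quintic $x^5-x+\gamma=0$. 1. Let $\gamma\neq 0$, let $\gamma^{1/5}$ be any choice of fifth root of $\gamma$, and put $\gamma^{4/5}=(\gamma^{1/5})^4$. For each $\ell=0,\dots,4$ the series $$x_\ell=e^{i\pi(2\ell+1)/5}\,\gamma^{1/5}\,\mathcal{B}\Bigl(\tfrac15;\tfrac15;-\frac{e^{i\pi(2\ell+1)/5}}{\gamma^{4/5}}\Bigr)$$ converges if and only if $|\gamma|\ge 4/5^{5/4}$. In that case $x_0,\dots,x_4$ are the five roots of $x^5-x+\gamma=0$, counted with multiplicity. 2. The series $$x=\gamma\,\mathcal{B}(5;1;\gamma^4),\qquad x_\ell=e^{i\pi\ell/2}\,\mathcal{B}\bigl(-\tfrac14;\tfrac14;-e^{-i\pi\ell/2}\gamma\bigr)\quad(\ell=0,\dots,3)$$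 each converge if and only if $|\gamma|\le 4/5^{5/4}$. In that case these five numbers together are the five roots of $x^5-x+\gamma=0$, counted with multiplicity. If $|\gamma|<4/5^{5/4}$, the first of them differs from each of the other four. As $\gamma\to 0$ the first tends to $0$ and $x_\ell$ tends to the fourth root of unity $e^{i\pi\ell/2}$. 3. Hence for every $\gamma\in\mathbb{C}$, a number is a root of $x^5-x+\gamma=0$ if and only if it is the value of one of the expressions in 1 (where $\gamma\ne0$) and 2 whose series converges; in particular, all roots are given by convergent series for all $\gamma$. -/

import Mathlib

open Polynomial

noncomputable section

/-- The Fuss–Catalan number `A_t(μ, r)`: `A_0(μ, r) = 1` and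
`A_t(μ, r) = (r / t!) ∏_{j=1}^{t-1} (t μ + r - j)` for `t ≥ 1`. -/
def fussCatalan (μ r : ℂ) (t : ℕ) : ℂ :=
  if t = 0 then 1
  else r / (t.factorial : ℂ) * ∏ j ∈ Finset.Icc 1 (t - 1), ((t : ℂ) * μ + r - (j : ℂ))

/-- Absolute convergence of the Fuss–Catalan series `∑_t A_t(μ, r) z^t`. -/
def FCConverges (μ r z : ℂ) : Prop :=
  Summable fun t : ℕ => ‖fussCatalan μ r t * z ^ t‖

/-- The sum `B(μ; r; z) = ∑_t A_t(μ, r) z^t` of the Fuss–Catalan series. -/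
def fcSeries (μ r z : ℂ) : ℂ :=
  ∑' t : ℕ, fussCatalan μ r t * z ^ t

/-- The critical modulus `4 / 5^{5/4}`. -/
def bjRadius : ℝ := 4 / (5 : ℝ) ^ ((5 : ℝ) / 4)

/-- The fifth root of `-1` given by `e^{iπ(2ℓ+1)/5}`. -/
def bjOmega (ℓ : ℕ) : ℂ :=
  Complex.exp (Complex.I * Real.pi * (2 * (ℓ : ℂ) + 1) / 5)

/-- The argument `-e^{iπ(2ℓ+1)/5} / γ^{4/5}` of the series with `μ = 1/5`. Here `δ` stands for
the chosen branch of `γ^{1/5}`, and `γ^{4/5} = δ^4`. -/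
def bjArg₁ (δ : ℂ) (ℓ : ℕ) : ℂ := -bjOmega ℓ / δ ^ 4

/-- `e^{iπ(2ℓ+1)/5} γ^{1/5} B(1/5; 1/5; -e^{iπ(2ℓ+1)/5} / γ^{4/5})`, where `δ = γ^{1/5}`. -/
def bjRoot₁ (δ : ℂ) (ℓ : ℕ) : ℂ :=
  bjOmega ℓ * δ * fcSeries (1 / 5) (1 / 5) (bjArg₁ δ ℓ)

/-- `γ B(5; 1; γ^4)`. -/
def bjRoot₂ (γ : ℂ) : ℂ := γ * fcSeries 5 1 (γ ^ 4)

/-- The argument `-e^{-iπℓ/2} γ` of the series with `μ = -1/4`. -/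
def bjArg₃ (γ : ℂ) (ℓ : ℕ) : ℂ :=
  -Complex.exp (-(Complex.I * Real.pi * (ℓ : ℂ) / 2)) * γ

/-- `e^{iπℓ/2} B(-1/4; 1/4; -e^{-iπℓ/2} γ)`. -/
def bjRoot₃ (γ : ℂ) (ℓ : ℕ) : ℂ :=
  Complex.exp (Complex.I * Real.pi * (ℓ : ℂ) / 2) * fcSeries (-1 / 4) (1 / 4) (bjArg₃ γ ℓ)

/-- The Bring–Jerrard quintic `x^5 - x + γ`. -/
def bringJerrard (γ : ℂ) : ℂ[X] := X ^ 5 - X + C γ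

end

/-! Two identities drive everything: B(μ;r;z) B(μ;s;z) = B(μ;r+s;z) (`fcSeries_add`, from the
Rothe–Hagen convolution) and B(μ;r+1;z) = B(μ;r;z) + z B(μ;r+μ;z) (`fcSeries_add_one`). At r = 0
they give trinomial equations, which make γ B(5;1;γ⁴) and the series with μ = 1/5 roots of the
quintic.

Multiplicities come from power sums. The k-th power of a candidate is again a Fuss–Catalan series,
and summing over the roots of unity in front leaves one residue class of exponents. For μ = 1/5 that
class has at most one nonzero term; for μ = -1/4 it cancels the k-th power of γ B(5;1;γ⁴), up to a
constant term. So the first four power sums are 0, 0, 0, 4 (`sum_bjRoot₁_pow`, `sum_bjRoot₃_pow`),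
and Newton's identities together with one known root fix the polynomial (`roots_bringJerrard`). The
critical circle needs no separate treatment.

Convergence: the coefficients at t + m and t have a rational quotient K q(t) with q(t) = 1 - 3m/(2t)
+ O(1/t²), so a Kummer test yields the closed disc K|z|^m ≤ 1 exactly (`fcConverges_iff_of_shift`).
-/

/-! ### Recurrence and convolution of Fuss–Catalan numbers. -/

/-- Fuss–Catalan numbers of positive index, as falling products. -/
theorem fussCatalan_succ (μ r : ℂ) (n : ℕ) :
    fussCatalan μ r (n + 1) = r / ((n + 1).factorial : ℂ) *
      ∏ i ∈ Finset.range n, (((n : ℂ) + 1) * μ + r - 1 - (i : ℂ)) := by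
  rw [fussCatalan, if_neg (Nat.succ_ne_zero n), Nat.add_sub_cancel,
    ← Finset.Ico_add_one_right_eq_Icc, Finset.prod_Ico_eq_prod_range, Nat.add_sub_cancel]
  congr 1
  refine Finset.prod_congr rfl fun i _ => ?_
  push_cast
  ring

theorem fussCatalan_zero (μ r : ℂ) : fussCatalan μ r 0 = 1 := by simp [fussCatalan]

theorem fussCatalan_one (μ r : ℂ) : fussCatalan μ r 1 = r := by simp [fussCatalan]

theorem fussCatalan_zero_right (μ : ℂ) (n : ℕ) : fussCatalan μ 0 (n + 1) = 0 := by
  simp [fussCatalan]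

theorem prod_range_add_one_sub (a : ℂ) (n : ℕ) :
    ∏ i ∈ Finset.range (n + 1), (a + 1 - (i : ℂ)) =
      (a + 1) * ∏ i ∈ Finset.range n, (a - (i : ℂ)) := by
  rw [Finset.prod_range_succ', mul_comm]
  congr 1
  · simp
  · refine Finset.prod_congr rfl fun i _ => ?_
    push_cast
    ring

/-- Pascal's rule: the three falling products agree up to one factor at the top or the bottom, and
what is left is a linear identity. -/
theorem fussCatalan_succ_add_one (μ r : ℂ) (n : ℕ) :
    fussCatalan μ (r + 1) (n + 1) = fussCatalan μ r (n + 1) + fussCatalan μ (r + μ) n := by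
  cases n with
  | zero => simp [fussCatalan]
  | succ n =>
    have hf : ((n + 1).factorial : ℂ) ≠ 0 := Nat.cast_ne_zero.mpr (Nat.factorial_ne_zero _)
    have hn : (n : ℂ) + 1 + 1 ≠ 0 := by exact_mod_cast Nat.succ_ne_zero (n + 1)
    have h1 : ((n + 1 + 1).factorial : ℂ) = ((n : ℂ) + 1 + 1) * ((n + 1).factorial : ℂ) := by
      rw [Nat.factorial_succ (n + 1)]; push_cast; ring
    have e1 : ∏ i ∈ Finset.range (n + 1), ((((n + 1 : ℕ) : ℂ) + 1) * μ + (r + 1) - 1 - (i : ℂ)) =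
        (((n : ℂ) + 1 + 1) * μ + r - 1 + 1) *
          ∏ i ∈ Finset.range n, (((n : ℂ) + 1 + 1) * μ + r - 1 - (i : ℂ)) := by
      rw [← prod_range_add_one_sub]
      refine Finset.prod_congr rfl fun i _ => ?_
      push_cast
      ring
    have e2 : ∏ i ∈ Finset.range n, (((n : ℂ) + 1) * μ + (r + μ) - 1 - (i : ℂ)) =
        ∏ i ∈ Finset.range n, (((n : ℂ) + 1 + 1) * μ + r - 1 - (i : ℂ)) := by
      refine Finset.prod_congr rfl fun i _ => ?_
      ring
    rw [fussCatalan_succ, fussCatalan_succ, fussCatalan_succ, e1, e2, Finset.prod_range_succ, h1]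
    push_cast
    field_simp
    ring

/-- Polynomial dependence on r reduces an identity in r to natural values of r. -/
theorem exists_polynomial_fussCatalan (μ : ℂ) (n : ℕ) :
    ∃ p : ℂ[X], ∀ r, p.eval r = fussCatalan μ r n := by
  cases n with
  | zero => exact ⟨1, fun r => by simp [fussCatalan]⟩
  | succ n =>
    refine ⟨X * C (1 / ((n + 1).factorial : ℂ)) *
      ∏ i ∈ Finset.range n, (X + C (((n : ℂ) + 1) * μ - 1 - (i : ℂ))), fun r => ?_⟩
    rw [fussCatalan_succ, eval_mul, eval_prod]
    congr 1
    · rw [eval_mul, eval_X, eval_C, mul_one_div]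
    · refine Finset.prod_congr rfl fun i _ => ?_
      simp
      ring

/-- The convolution identity of Rothe and Hagen. -/
theorem sum_antidiagonal_fussCatalan (μ : ℂ) (n : ℕ) : ∀ r s : ℂ,
    ∑ p ∈ Finset.HasAntidiagonal.antidiagonal n, fussCatalan μ r p.1 * fussCatalan μ s p.2 =
      fussCatalan μ (r + s) n := by
  induction n with
  | zero => intro r s; simp [fussCatalan]
  | succ n ih =>
    intro r s
    choose P hP using exists_polynomial_fussCatalan μ
    -- The defect of the identity as a polynomial in r. Pascal's rule and the identity in degree n
    -- make it 1-periodic; it vanishes at 0, hence at every natural number, hence identically.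
    set Q : ℂ[X] := ∑ p ∈ Finset.HasAntidiagonal.antidiagonal (n + 1), P p.1 * C (fussCatalan μ s p.2) -
      (P (n + 1)).comp (X + C s) with hQ
    have hQe : ∀ x, Q.eval x = ∑ p ∈ Finset.HasAntidiagonal.antidiagonal (n + 1),
        fussCatalan μ x p.1 * fussCatalan μ s p.2 - fussCatalan μ (x + s) (n + 1) := by
      intro x
      simp [hQ, eval_finsetSum, hP]
    have hstep : ∀ x, Q.eval (x + 1) = Q.eval x := by
      intro x
      have h := ih (x + μ) s
      rw [hQe, hQe, Finset.Nat.sum_antidiagonal_succ, Finset.Nat.sum_antidiagonal_succ,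
        show x + 1 + s = x + s + 1 by ring, fussCatalan_succ_add_one,
        show x + s + μ = x + μ + s by ring, ← h]
      simp only [fussCatalan_succ_add_one, add_mul, Finset.sum_add_distrib, fussCatalan_zero]
      ring
    have h0 : Q.eval 0 = 0 := by
      rw [hQe, Finset.Nat.sum_antidiagonal_succ]
      simp [fussCatalan_zero_right, fussCatalan_zero]
    have hnat : ∀ k : ℕ, Q.eval (k : ℂ) = 0 := by
      intro k
      induction k with
      | zero => simpa using h0
      | succ k ihk => rw [Nat.cast_succ, hstep, ihk]
    have hQ0 : Q = 0 := by
      refine Polynomial.eq_zero_of_infinite_isRoot Q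
        (Set.Infinite.mono ?_ (Set.infinite_range_of_injective (Nat.cast_injective (R := ℂ))))
      rintro _ ⟨k, rfl⟩
      exact hnat k
    have := hQe r
    rw [hQ0, eval_zero] at this
    exact (sub_eq_zero.mp this.symm)

theorem antidiagonal_fussCatalan_mul_pow (μ r s z : ℂ) (n : ℕ) :
    ∑ p ∈ Finset.HasAntidiagonal.antidiagonal n,
      (fussCatalan μ r p.1 * z ^ p.1) * (fussCatalan μ s p.2 * z ^ p.2) =
      fussCatalan μ (r + s) n * z ^ n := by
  rw [← sum_antidiagonal_fussCatalan, Finset.sum_mul]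
  refine Finset.sum_congr rfl fun p hp => ?_
  rw [← Finset.HasAntidiagonal.mem_antidiagonal.mp hp, pow_add]
  ring

/-! ### Functional equations of the series. -/

theorem FCConverges.add {μ r s z : ℂ} (hr : FCConverges μ r z) (hs : FCConverges μ s z) :
    FCConverges μ (r + s) z := by
  have := summable_norm_sum_mul_antidiagonal_of_summable_norm hr hs
  simp only [antidiagonal_fussCatalan_mul_pow] at this
  exact this

theorem fcSeries_add {μ r s z : ℂ} (hr : FCConverges μ r z) (hs : FCConverges μ s z) :
    fcSeries μ (r + s) z = fcSeries μ r z * fcSeries μ s z := by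
  have := tsum_mul_tsum_eq_tsum_sum_antidiagonal_of_summable_norm hr hs
  simp only [antidiagonal_fussCatalan_mul_pow] at this
  exact this.symm

theorem hasSum_fussCatalan_zero (μ z : ℂ) :
    HasSum (fun t => fussCatalan μ 0 t * z ^ t) 1 := by
  have h : ∀ t ≠ 0, fussCatalan μ 0 t * z ^ t = 0 := by
    intro t ht
    obtain ⟨n, rfl⟩ := Nat.exists_eq_succ_of_ne_zero ht
    rw [Nat.succ_eq_add_one, fussCatalan_zero_right, zero_mul]
  simpa [fussCatalan_zero] using hasSum_single 0 h

theorem fcSeries_zero (μ z : ℂ) : fcSeries μ 0 z = 1 := (hasSum_fussCatalan_zero μ z).tsum_eq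

theorem fcConverges_zero (μ z : ℂ) : FCConverges μ 0 z :=
  (hasSum_fussCatalan_zero μ z).summable.norm

theorem fcConverges_natCast_mul {μ r z : ℂ} (hr : FCConverges μ r z) (k : ℕ) :
    FCConverges μ (k * r) z := by
  induction k with
  | zero => simpa using fcConverges_zero μ z
  | succ k ih => simpa [add_mul] using ih.add hr

theorem fcSeries_natCast_mul {μ r z : ℂ} (hr : FCConverges μ r z) (k : ℕ) :
    fcSeries μ (k * r) z = fcSeries μ r z ^ k := by
  induction k with
  | zero => simpa using fcSeries_zero μ z
  | succ k ih =>
    rw [pow_succ, ← ih, ← fcSeries_add (fcConverges_natCast_mul hr k) hr]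
    push_cast
    ring_nf

theorem fcSeries_add_one {μ r z : ℂ} (hr : FCConverges μ r z)
    (hrμ : FCConverges μ (r + μ) z) :
    fcSeries μ (r + 1) z = fcSeries μ r z + z * fcSeries μ (r + μ) z := by
  have h1 := (hasSum_nat_add_iff' 1).mpr hr.of_norm.hasSum
  have h2 := hrμ.of_norm.hasSum.mul_left z
  have h3 := h1.add h2
  have h4 : HasSum (fun n => fussCatalan μ (r + 1) (n + 1) * z ^ (n + 1))
      (fcSeries μ r z - 1 + z * fcSeries μ (r + μ) z) := by
    have e1 : fcSeries μ r z - 1 + z * fcSeries μ (r + μ) z =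
        ∑' t, fussCatalan μ r t * z ^ t - ∑ i ∈ Finset.range 1, fussCatalan μ r i * z ^ i +
          z * ∑' t, fussCatalan μ (r + μ) t * z ^ t := by
      simp [fcSeries, fussCatalan_zero]
    rw [e1]
    refine h3.congr_fun fun n => ?_
    rw [fussCatalan_succ_add_one]
    ring
  have h5 := ((hasSum_nat_add_iff (f := fun n => fussCatalan μ (r + 1) n * z ^ n) 1).mp h4).tsum_eq
  rw [fcSeries, h5]
  simp [fussCatalan_zero]
  ring
-- Convergence tests that include the boundary circle.
open Filter Topology

/-- A Kummer type convergence test for sequences with control on `f (t + m) / f t`. -/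
theorem summable_of_shift_le {f : ℕ → ℝ} (hf : ∀ t, 0 ≤ f t) (m : ℕ) {c : ℝ} (hc : 0 < c)
    (h : ∀ t : ℕ, 1 ≤ t → ((t : ℝ) + m) * f (t + m) ≤ ((t : ℝ) - c) * f t) : Summable f := by
  -- Telescoping: moving the window of m weighted terms `t * f t` one step to the right lowers its
  -- sum by at least `c * f (n + 1)`.
  have key : ∀ n, c * ∑ t ∈ Finset.range n, f (t + 1) ≤
      ∑ i ∈ Finset.range m, ((i : ℝ) + 1) * f (i + 1) -
        ∑ i ∈ Finset.range m, ((n : ℝ) + i + 1) * f (n + i + 1) := by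
    intro n
    induction n with
    | zero => simp
    | succ n ih =>
      have h1 := h (n + 1) (by omega)
      have h2 : ∑ i ∈ Finset.range m, (((n + 1 : ℕ) : ℝ) + i + 1) * f (n + 1 + i + 1) +
          ((n : ℝ) + 1) * f (n + 1) =
          ∑ i ∈ Finset.range m, ((n : ℝ) + i + 1) * f (n + i + 1) +
            ((n : ℝ) + m + 1) * f (n + m + 1) := by
        have e1 := Finset.sum_range_succ (fun i : ℕ => ((n : ℝ) + i + 1) * f (n + i + 1)) m
        have e2 := Finset.sum_range_succ' (fun i : ℕ => ((n : ℝ) + i + 1) * f (n + i + 1)) m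
        rw [← e1, e2]
        congr 1
        · refine Finset.sum_congr rfl fun i _ => ?_
          rw [show n + 1 + i + 1 = n + (i + 1) + 1 by ring]
          push_cast
          ring
        · simp
      rw [show n + 1 + m = n + m + 1 by ring] at h1
      push_cast at h1
      rw [Finset.sum_range_succ]
      linarith
  rw [← summable_nat_add_iff 1]
  refine summable_of_sum_range_le (fun t => hf _)
    (c := (∑ i ∈ Finset.range m, ((i : ℝ) + 1) * f (i + 1)) / c) fun n => ?_
  rw [le_div_iff₀ hc, mul_comm]
  have h3 : 0 ≤ ∑ i ∈ Finset.range m, ((n : ℝ) + i + 1) * f (n + i + 1) :=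
    Finset.sum_nonneg fun i _ => mul_nonneg (by positivity) (hf _)
  linarith [key n]

/-- Power series whose coefficients have quotients `K * q t` under shift by `m`, where `q`
tends to `1` from below at a definite rate, converge exactly on a closed disc. -/
theorem summable_mul_pow_iff_of_shift {f : ℕ → ℝ} (hf : ∀ t, 0 ≤ f t) (hf1 : 0 < f 1) {m : ℕ}
    (hm : 0 < m) {K c : ℝ} (hK : 0 < K) (hc : 0 < c) {q : ℕ → ℝ}
    (hrec : ∀ t, 1 ≤ t → f (t + m) = K * q t * f t) (hq0 : ∀ t, 1 ≤ t → 0 < q t)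
    (hq : ∀ t : ℕ, 1 ≤ t → ((t : ℝ) + m) * q t ≤ (t : ℝ) - c) (hlim : Tendsto q atTop (𝓝 1))
    {ρ : ℝ} (hρ : 0 ≤ ρ) : Summable (fun t => f t * ρ ^ t) ↔ K * ρ ^ m ≤ 1 := by
  constructor
  · intro hs
    by_contra! hlt
    have hρ0 : 0 < ρ := by
      rcases hρ.eq_or_lt with h | h
      · rw [← h, zero_pow hm.ne', mul_zero] at hlt
        linarith
      · exact h
    -- Coefficients in other residue classes may vanish, so the ratio test is run only along the
    -- class of 1, where positivity propagates from `f 1`.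
    set g : ℕ → ℕ := fun k => 1 + m * k with hg
    have hg1 : ∀ k, 1 ≤ g k := fun k => by simp [hg]
    have hgs : ∀ k, g (k + 1) = g k + m := fun k => by simp only [hg]; ring
    have hinj : StrictMono g := strictMono_nat_of_lt_succ fun k => by rw [hgs]; omega
    have hpos : ∀ k, 0 < f (g k) := by
      intro k
      induction k with
      | zero => simpa [hg] using hf1
      | succ k ih =>
        rw [hgs, hrec _ (hg1 k)]
        exact mul_pos (mul_pos hK (hq0 _ (hg1 k))) ih
    refine not_summable_of_ratio_test_tendsto_gt_one hlt ?_ (hs.comp_injective hinj.injective)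
    have h1 : Tendsto (fun k => K * q (g k) * ρ ^ m) atTop (𝓝 (K * 1 * ρ ^ m)) :=
      ((hlim.comp hinj.tendsto_atTop).const_mul K).mul_const _
    rw [mul_one] at h1
    refine h1.congr fun k => ?_
    have hp : 0 < f (g k) * ρ ^ g k := mul_pos (hpos k) (pow_pos hρ0 _)
    have hp' : 0 < f (g (k + 1)) * ρ ^ g (k + 1) := mul_pos (hpos _) (pow_pos hρ0 _)
    simp only [Function.comp_apply]
    rw [Real.norm_of_nonneg hp.le, Real.norm_of_nonneg hp'.le, eq_div_iff hp.ne', hgs,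
      hrec _ (hg1 k), pow_add]
    ring
  · intro hle
    refine summable_of_shift_le (fun t => mul_nonneg (hf t) (pow_nonneg hρ t)) m hc fun t ht => ?_
    have h1 : 0 ≤ f t * ρ ^ t := mul_nonneg (hf t) (pow_nonneg hρ t)
    have h2 : 0 ≤ ((t : ℝ) + m) * q t := mul_nonneg (by positivity) (hq0 t ht).le
    calc ((t : ℝ) + m) * (f (t + m) * ρ ^ (t + m))
        = (K * ρ ^ m) * (((t : ℝ) + m) * q t * (f t * ρ ^ t)) := by
          rw [hrec t ht, pow_add]; ring
      _ ≤ 1 * (((t : ℝ) + m) * q t * (f t * ρ ^ t)) :=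
          mul_le_mul_of_nonneg_right hle (mul_nonneg h2 h1)
      _ ≤ ((t : ℝ) - c) * (f t * ρ ^ t) := by
          rw [one_mul]
          exact mul_le_mul_of_nonneg_right (hq t ht) h1

theorem tendsto_natCast_add_div_natCast_add (a b : ℝ) :
    Tendsto (fun t : ℕ => ((t : ℝ) + a) / ((t : ℝ) + b)) atTop (𝓝 1) := by
  have h0 : Tendsto (fun t : ℕ => (t : ℝ) + b) atTop atTop :=
    tendsto_atTop_add_const_right _ _ tendsto_natCast_atTop_atTop
  have h1 : Tendsto (fun t : ℕ => 1 + (a - b) / ((t : ℝ) + b)) atTop (𝓝 (1 + 0)) :=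
    (h0.const_div_atTop (a - b)).const_add 1
  rw [add_zero] at h1
  refine h1.congr' ?_
  filter_upwards [h0.eventually_gt_atTop 0] with t ht
  field_simp
  ring

/-- Convergence of a Fuss–Catalan series whose coefficients have a rational quotient under
shift by `m`. -/
theorem fcConverges_iff_of_shift {μ r : ℂ} (hr : r ≠ 0) {m : ℕ} (hm : 0 < m) {K c : ℝ}
    (hK : 0 < K) (hc : 0 < c) {a b : Fin 4 → ℝ} (ha : ∀ i, 0 < 1 + a i) (hb : ∀ i, 0 < 1 + b i)
    (hrec : ∀ t : ℕ, 1 ≤ t → fussCatalan μ r (t + m) =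
      ((K * ∏ i, (((t : ℝ) + a i) / ((t : ℝ) + b i)) : ℝ) : ℂ) * fussCatalan μ r t)
    (hq : ∀ t : ℕ, 1 ≤ t →
      ((t : ℝ) + m) * ∏ i, (((t : ℝ) + a i) / ((t : ℝ) + b i)) ≤ (t : ℝ) - c) (z : ℂ) :
    FCConverges μ r z ↔ K * ‖z‖ ^ m ≤ 1 := by
  have hq0 : ∀ t : ℕ, 1 ≤ t → 0 < ∏ i, (((t : ℝ) + a i) / ((t : ℝ) + b i)) := by
    intro t ht
    have ht' : (1 : ℝ) ≤ t := by exact_mod_cast ht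
    exact Finset.prod_pos fun i _ => div_pos (by linarith [ha i]) (by linarith [hb i])
  have hlim : Tendsto (fun t : ℕ => ∏ i, (((t : ℝ) + a i) / ((t : ℝ) + b i))) atTop (𝓝 1) := by
    have := tendsto_finsetProd (Finset.univ : Finset (Fin 4)) fun i _ =>
      tendsto_natCast_add_div_natCast_add (a i) (b i)
    simpa using this
  have h := summable_mul_pow_iff_of_shift (f := fun t => ‖fussCatalan μ r t‖)
    (fun t => norm_nonneg _) (by simpa [fussCatalan_one] using hr) hm hK hc
    (fun t ht => by
      simp only [hrec t ht, norm_mul]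
      rw [Complex.norm_real, Real.norm_of_nonneg (mul_pos hK (hq0 t ht)).le]) hq0 hq hlim
    (norm_nonneg z)
  rw [← h, FCConverges]
  simp only [norm_mul, norm_pow]

/-! ### Quotients of shifted coefficients and the three discs of convergence. -/

theorem prod_range_add_sub (a : ℂ) (k n : ℕ) :
    ∏ i ∈ Finset.range (n + k), (a + k - (i : ℂ)) =
      (∏ i ∈ Finset.range k, (a + k - (i : ℂ))) * ∏ i ∈ Finset.range n, (a - (i : ℂ)) := by
  rw [add_comm n k, Finset.prod_range_add]
  congr 1
  refine Finset.prod_congr rfl fun i _ => ?_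
  push_cast
  ring

theorem natCast_add_ofNat_ne_zero (n k : ℕ) (hk : k ≠ 0) : (n : ℂ) + k ≠ 0 := by
  rw [← Nat.cast_add]
  exact Nat.cast_ne_zero.mpr (by omega)

/-- Raising t by 5 raises the top of the falling product by 1 and its length by 5: one new factor
above and four below. The upper one cancels against the factorial. -/
theorem fussCatalan_fifth_shift (t : ℕ) (ht : 1 ≤ t) :
    fussCatalan (1 / 5) (1 / 5) (t + 5) =
      ((256 / 3125 * ∏ i, (((t : ℝ) + ![-1 / 4, 1, 9 / 4, 14 / 4] i) /
        ((t : ℝ) + ![2, 3, 4, 5] i)) : ℝ) : ℂ) * fussCatalan (1 / 5) (1 / 5) t := by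
  obtain ⟨n, rfl⟩ : ∃ n, t = n + 1 := ⟨t - 1, by omega⟩
  rw [show n + 1 + 5 = (n + 5) + 1 by ring, fussCatalan_succ, fussCatalan_succ]
  set a : ℂ := ((n : ℂ) + 1) * (1 / 5) + 1 / 5 - 1 with ha
  rw [show (((n + 5 : ℕ) : ℂ) + 1) * (1 / 5) + 1 / 5 - 1 = a + (1 : ℕ) by
      rw [ha]; push_cast; ring,
    show n + 5 = (n + 4) + 1 by ring, prod_range_add_sub a 1 (n + 4), Finset.prod_range_add _ n 4]
  have hf : (((n + 1).factorial : ℕ) : ℂ) ≠ 0 := Nat.cast_ne_zero.mpr (Nat.factorial_ne_zero _)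
  have hF : ((n + 4 + 1 + 1).factorial : ℂ) =
      (n + 6) * (n + 5) * (n + 4) * (n + 3) * (n + 2) * ((n + 1).factorial : ℂ) := by
    simp only [Nat.factorial_succ (n + 4 + 1), Nat.factorial_succ (n + 4),
      Nat.factorial_succ (n + 3), Nat.factorial_succ (n + 2), Nat.factorial_succ (n + 1)]
    push_cast
    ring
  have h2 : (n : ℂ) + 2 ≠ 0 := natCast_add_ofNat_ne_zero n 2 (by norm_num)
  have h3 : (n : ℂ) + 3 ≠ 0 := natCast_add_ofNat_ne_zero n 3 (by norm_num)
  have h4 : (n : ℂ) + 4 ≠ 0 := natCast_add_ofNat_ne_zero n 4 (by norm_num)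
  have h5 : (n : ℂ) + 5 ≠ 0 := natCast_add_ofNat_ne_zero n 5 (by norm_num)
  have h6 : (n : ℂ) + 6 ≠ 0 := natCast_add_ofNat_ne_zero n 6 (by norm_num)
  have hp : ((256 / 3125 * ∏ i, ((((n + 1 : ℕ) : ℝ) + ![-1 / 4, 1, 9 / 4, 14 / 4] i) /
        (((n + 1 : ℕ) : ℝ) + ![2, 3, 4, 5] i)) : ℝ) : ℂ) =
      (4 * n + 3) * (4 * n + 8) * (4 * n + 13) * (4 * n + 18) /
        (3125 * ((n + 3) * (n + 4) * (n + 5) * (n + 6))) := by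
    simp only [Fin.prod_univ_four]
    simp
    rw [show (n : ℂ) + 1 + 2 = n + 3 by ring, show (n : ℂ) + 1 + 3 = n + 4 by ring,
      show (n : ℂ) + 1 + 4 = n + 5 by ring, show (n : ℂ) + 1 + 5 = n + 6 by ring]
    field_simp
    ring
  rw [hp, hF]
  generalize ∏ i ∈ Finset.range n, (a - (i : ℂ)) = P
  simp only [Finset.prod_range_succ, Finset.prod_range_zero]
  rw [ha]
  push_cast
  field_simp
  ring

theorem fussCatalan_neg_fourth_shift (t : ℕ) (ht : 1 ≤ t) :
    fussCatalan (-1 / 4) (1 / 4) (t + 4) =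
      ((3125 / 256 * ∏ i, (((t : ℝ) + ![-1 / 5, 3 / 5, 7 / 5, 11 / 5] i) /
        ((t : ℝ) + ![1, 2, 3, 4] i)) : ℝ) : ℂ) * fussCatalan (-1 / 4) (1 / 4) t := by
  obtain ⟨n, rfl⟩ : ∃ n, t = n + 1 := ⟨t - 1, by omega⟩
  rw [show n + 1 + 4 = (n + 4) + 1 by ring, fussCatalan_succ, fussCatalan_succ]
  set a : ℂ := (((n + 4 : ℕ) : ℂ) + 1) * (-1 / 4) + 1 / 4 - 1 with ha
  rw [show ((n : ℂ) + 1) * (-1 / 4) + 1 / 4 - 1 = a + (1 : ℕ) by rw [ha]; push_cast; ring]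
  -- The top of the product now drops by 1. Splitting the product of length n + 5 from either end
  -- compares the old product P with the new product Q.
  have hP := prod_range_add_sub a 1 (n + 4)
  rw [show n + 4 + 1 = n + 5 by ring, Finset.prod_range_add _ n 5] at hP
  have hf : (((n + 1).factorial : ℕ) : ℂ) ≠ 0 := Nat.cast_ne_zero.mpr (Nat.factorial_ne_zero _)
  have hF : ((n + 4 + 1).factorial : ℂ) =
      (n + 5) * (n + 4) * (n + 3) * (n + 2) * ((n + 1).factorial : ℂ) := by
    simp only [Nat.factorial_succ (n + 4),
      Nat.factorial_succ (n + 3), Nat.factorial_succ (n + 2), Nat.factorial_succ (n + 1)]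
    push_cast
    ring
  have h2 : (n : ℂ) + 2 ≠ 0 := natCast_add_ofNat_ne_zero n 2 (by norm_num)
  have h3 : (n : ℂ) + 3 ≠ 0 := natCast_add_ofNat_ne_zero n 3 (by norm_num)
  have h4 : (n : ℂ) + 4 ≠ 0 := natCast_add_ofNat_ne_zero n 4 (by norm_num)
  have h5 : (n : ℂ) + 5 ≠ 0 := natCast_add_ofNat_ne_zero n 5 (by norm_num)
  have hp : ((3125 / 256 * ∏ i, ((((n + 1 : ℕ) : ℝ) + ![-1 / 5, 3 / 5, 7 / 5, 11 / 5] i) /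
        (((n + 1 : ℕ) : ℝ) + ![1, 2, 3, 4] i)) : ℝ) : ℂ) =
      5 * (5 * n + 4) * (5 * n + 8) * (5 * n + 12) * (5 * n + 16) /
        (256 * ((n + 2) * (n + 3) * (n + 4) * (n + 5))) := by
    simp only [Fin.prod_univ_four]
    simp
    rw [show (n : ℂ) + 1 + 1 = n + 2 by ring, show (n : ℂ) + 1 + 2 = n + 3 by ring,
      show (n : ℂ) + 1 + 3 = n + 4 by ring, show (n : ℂ) + 1 + 4 = n + 5 by ring]
    field_simp
    ring
  rw [hp, hF]
  generalize ∏ i ∈ Finset.range n, (a + (1 : ℕ) - (i : ℂ)) = P at hP ⊢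
  generalize ∏ i ∈ Finset.range (n + 4), (a - (i : ℂ)) = Q at hP ⊢
  have ha' : a = -(n + 8) / 4 := by rw [ha]; push_cast; ring
  have hQ : (n + 4) * Q = (5 * n + 4) * (5 * n + 8) * (5 * n + 12) * (5 * n + 16) * (5 * n + 20) /
      256 * P := by
    simp only [Finset.prod_range_succ, Finset.prod_range_zero, ha'] at hP
    push_cast at hP
    linear_combination 4 * hP
  have hQ' : Q = 5 * ((5 * n + 4) * (5 * n + 8) * (5 * n + 12) * (5 * n + 16)) / 256 * P := by
    refine mul_left_cancel₀ h4 (hQ.trans ?_)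
    ring
  rw [hQ']
  field_simp

set_option maxHeartbeats 1000000 in
theorem fussCatalan_five_shift (t : ℕ) (ht : 1 ≤ t) :
    fussCatalan 5 1 (t + 1) =
      ((3125 / 256 * ∏ i, (((t : ℝ) + ![1 / 5, 2 / 5, 3 / 5, 4 / 5] i) /
        ((t : ℝ) + ![1 / 2, 3 / 4, 1, 5 / 4] i)) : ℝ) : ℂ) * fussCatalan 5 1 t := by
  obtain ⟨n, rfl⟩ : ∃ n, t = n + 1 := ⟨t - 1, by omega⟩
  rw [fussCatalan_succ, fussCatalan_succ]
  set a : ℂ := ((n : ℂ) + 1) * 5 + 1 - 1 with ha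
  rw [show (((n + 1 : ℕ) : ℂ) + 1) * 5 + 1 - 1 = a + (5 : ℕ) by rw [ha]; push_cast; ring]
  -- The top rises by 5 and the length by 1; the product of length n + 5 contains both the old
  -- product (below five factors) and the new one (above four).
  have hP := prod_range_add_sub a 5 n
  rw [show n + 5 = n + 1 + 4 by ring, Finset.prod_range_add _ (n + 1) 4] at hP
  have hf : (((n + 1).factorial : ℕ) : ℂ) ≠ 0 := Nat.cast_ne_zero.mpr (Nat.factorial_ne_zero _)
  have hF : ((n + 1 + 1).factorial : ℂ) = (n + 2) * ((n + 1).factorial : ℂ) := by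
    rw [Nat.factorial_succ (n + 1)]
    push_cast
    ring
  have h2 : (n : ℂ) + 2 ≠ 0 := natCast_add_ofNat_ne_zero n 2 (by norm_num)
  have h6 : 4 * (n : ℂ) + 6 ≠ 0 := by
    exact_mod_cast natCast_add_ofNat_ne_zero (4 * n) 6 (by norm_num)
  have h7 : 4 * (n : ℂ) + 7 ≠ 0 := by
    exact_mod_cast natCast_add_ofNat_ne_zero (4 * n) 7 (by norm_num)
  have h8 : 4 * (n : ℂ) + 8 ≠ 0 := by
    exact_mod_cast natCast_add_ofNat_ne_zero (4 * n) 8 (by norm_num)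
  have h9 : 4 * (n : ℂ) + 9 ≠ 0 := by
    exact_mod_cast natCast_add_ofNat_ne_zero (4 * n) 9 (by norm_num)
  have hp : ((3125 / 256 * ∏ i, ((((n + 1 : ℕ) : ℝ) + ![1 / 5, 2 / 5, 3 / 5, 4 / 5] i) /
        (((n + 1 : ℕ) : ℝ) + ![1 / 2, 3 / 4, 1, 5 / 4] i)) : ℝ) : ℂ) =
      5 * (5 * n + 6) * (5 * n + 7) * (5 * n + 8) * (5 * n + 9) /
        ((4 * n + 6) * (4 * n + 7) * (4 * n + 8) * (4 * n + 9)) := by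
    simp only [Fin.prod_univ_four]
    simp
    rw [show (n : ℂ) + 1 + 2⁻¹ = (4 * n + 6) / 4 by ring,
      show (n : ℂ) + 1 + 3 / 4 = (4 * n + 7) / 4 by ring,
      show (n : ℂ) + 1 + 1 = (4 * n + 8) / 4 by ring,
      show (n : ℂ) + 1 + 5 / 4 = (4 * n + 9) / 4 by ring]
    field_simp
    ring
  rw [hp, hF]
  generalize ∏ i ∈ Finset.range n, (a - (i : ℂ)) = P at hP ⊢
  generalize ∏ i ∈ Finset.range (n + 1), (a + (5 : ℕ) - (i : ℂ)) = Q at hP ⊢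
  have hQ : (4 * n + 6) * (4 * n + 7) * (4 * n + 8) * (4 * n + 9) * Q =
      (5 * n + 6) * (5 * n + 7) * (5 * n + 8) * (5 * n + 9) * (5 * n + 10) * P := by
    simp only [Finset.prod_range_succ, Finset.prod_range_zero, ha] at hP
    push_cast at hP
    linear_combination hP
  have hQ' : Q = (5 * n + 6) * (5 * n + 7) * (5 * n + 8) * (5 * n + 9) * (5 * n + 10) /
      ((4 * n + 6) * (4 * n + 7) * (4 * n + 8) * (4 * n + 9)) * P := by
    rw [div_mul_eq_mul_div, eq_div_iff (mul_ne_zero (mul_ne_zero (mul_ne_zero h6 h7) h8) h9), ← hQ, mul_comm]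
  rw [hQ']
  field_simp
  ring

theorem fcConverges_fifth_iff (z : ℂ) :
    FCConverges (1 / 5) (1 / 5) z ↔ 256 / 3125 * ‖z‖ ^ 5 ≤ 1 := by
  -- In all three cases the left side of the Kummer bound is t - m/2 + O(1/t), and 1/8 is small
  -- enough to work from t = 1 on. Writing t = n + 1 turns the cleared inequality into a polynomial
  -- in n with nonnegative coefficients.
  refine fcConverges_iff_of_shift (c := 1 / 8) (by norm_num) (by norm_num) (by norm_num)
    (by norm_num) ?_ ?_ fussCatalan_fifth_shift ?_ z
  · intro i; fin_cases i <;> norm_num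
  · intro i; fin_cases i <;> norm_num
  · intro t ht
    obtain ⟨n, rfl⟩ : ∃ n, t = n + 1 := ⟨t - 1, by omega⟩
    simp only [Fin.prod_univ_four]
    simp
    rw [div_mul_div_comm, div_mul_div_comm, div_mul_div_comm, ← mul_div_assoc,
      div_le_iff₀ (by positivity), ← sub_nonneg]
    ring_nf
    positivity

theorem fcConverges_neg_fourth_iff (z : ℂ) :
    FCConverges (-1 / 4) (1 / 4) z ↔ 3125 / 256 * ‖z‖ ^ 4 ≤ 1 := by
  refine fcConverges_iff_of_shift (c := 1 / 8) (by norm_num) (by norm_num) (by norm_num)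
    (by norm_num) ?_ ?_ fussCatalan_neg_fourth_shift ?_ z
  · intro i; fin_cases i <;> norm_num
  · intro i; fin_cases i <;> norm_num
  · intro t ht
    obtain ⟨n, rfl⟩ : ∃ n, t = n + 1 := ⟨t - 1, by omega⟩
    simp only [Fin.prod_univ_four]
    simp
    rw [div_mul_div_comm, div_mul_div_comm, div_mul_div_comm, ← mul_div_assoc,
      div_le_iff₀ (by positivity), ← sub_nonneg]
    ring_nf
    positivity

theorem fcConverges_five_iff (z : ℂ) : FCConverges 5 1 z ↔ 3125 / 256 * ‖z‖ ≤ 1 := by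
  have h := fcConverges_iff_of_shift (c := 1 / 8) (by norm_num) (by norm_num) (by norm_num)
    (by norm_num) ?_ ?_ fussCatalan_five_shift ?_ z
  · rwa [pow_one] at h
  · intro i; fin_cases i <;> norm_num
  · intro i; fin_cases i <;> norm_num
  · intro t ht
    obtain ⟨n, rfl⟩ : ∃ n, t = n + 1 := ⟨t - 1, by omega⟩
    simp only [Fin.prod_univ_four]
    simp
    rw [div_mul_div_comm, div_mul_div_comm, div_mul_div_comm, ← mul_div_assoc,
      div_le_iff₀ (by positivity), ← sub_nonneg]
    ring_nf
    positivity

/-! ### The critical modulus and the series with μ = 1/5. -/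

theorem bjRadius_pos : 0 < bjRadius := by
  unfold bjRadius
  positivity

theorem bjRadius_pow_four : bjRadius ^ 4 = 256 / 3125 := by
  rw [bjRadius, div_pow, ← Real.rpow_natCast ((5 : ℝ) ^ ((5 : ℝ) / 4)) 4,
    ← Real.rpow_mul (by norm_num)]
  norm_num

theorem le_bjRadius_iff {x : ℝ} (hx : 0 ≤ x) : x ≤ bjRadius ↔ x ^ 4 ≤ 256 / 3125 := by
  rw [← bjRadius_pow_four, pow_le_pow_iff_left₀ hx bjRadius_pos.le (by norm_num)]

theorem bjRadius_le_iff {x : ℝ} (hx : 0 ≤ x) : bjRadius ≤ x ↔ 256 / 3125 ≤ x ^ 4 := by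
  rw [← bjRadius_pow_four, pow_le_pow_iff_left₀ bjRadius_pos.le hx (by norm_num)]

theorem bjOmega_pow_five (ℓ : ℕ) : bjOmega ℓ ^ 5 = -1 := by
  rw [bjOmega, ← Complex.exp_nat_mul,
    show ((5 : ℕ) : ℂ) * (Complex.I * Real.pi * (2 * (ℓ : ℂ) + 1) / 5) =
      ℓ * (2 * Real.pi * Complex.I) + Real.pi * Complex.I by push_cast; ring,
    Complex.exp_add, Complex.exp_nat_mul, Complex.exp_two_pi_mul_I, one_pow, one_mul,
    Complex.exp_pi_mul_I]

theorem norm_bjOmega (ℓ : ℕ) : ‖bjOmega ℓ‖ = 1 := by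
  have h : ‖bjOmega ℓ‖ ^ 5 = 1 := by rw [← norm_pow, bjOmega_pow_five, norm_neg, norm_one]
  exact (pow_eq_one_iff_of_nonneg (norm_nonneg _) (by norm_num)).mp h

theorem bjOmega_eq_mul_pow (ℓ : ℕ) :
    bjOmega ℓ = bjOmega 0 * Complex.exp (2 * Real.pi * Complex.I / (5 : ℕ)) ^ ℓ := by
  rw [bjOmega, bjOmega, ← Complex.exp_nat_mul, ← Complex.exp_add]
  congr 1
  push_cast
  ring

theorem sum_pow_eq_zero_of_pow_eq_one {x : ℂ} {m : ℕ} (hx : x ≠ 1) (hm : x ^ m = 1) :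
    ∑ ℓ ∈ Finset.range m, x ^ ℓ = 0 := by
  have h := mul_geom_sum x m
  rw [hm, sub_self] at h
  exact (mul_eq_zero.mp h).resolve_left (sub_ne_zero.mpr hx)

theorem sum_bjOmega_pow {n : ℕ} (hn : ¬ 5 ∣ n) : ∑ ℓ ∈ Finset.range 5, bjOmega ℓ ^ n = 0 := by
  have hζ := Complex.isPrimitiveRoot_exp 5 (by norm_num)
  set ζ := Complex.exp (2 * Real.pi * Complex.I / (5 : ℕ)) with hζd
  have h1 : ∀ ℓ ∈ Finset.range 5, bjOmega ℓ ^ n = bjOmega 0 ^ n * (ζ ^ n) ^ ℓ := by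
    intro ℓ _
    rw [bjOmega_eq_mul_pow, mul_pow, ← hζd, ← pow_mul, ← pow_mul, mul_comm ℓ n]
  rw [Finset.sum_congr rfl h1, ← Finset.mul_sum, sum_pow_eq_zero_of_pow_eq_one, mul_zero]
  · exact fun h => hn ((hζ.pow_eq_one_iff_dvd n).mp h)
  · rw [← pow_mul, mul_comm, pow_mul, hζ.pow_eq_one, one_pow]

theorem fcConverges_bjArg₁_iff {γ δ : ℂ} (hγ : γ ≠ 0) (hδ : δ ^ 5 = γ) (ℓ : ℕ) :
    FCConverges (1 / 5) (1 / 5) (bjArg₁ δ ℓ) ↔ bjRadius ≤ ‖γ‖ := by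
  have hpos : 0 < ‖γ‖ := norm_pos_iff.mpr hγ
  have h1 : ‖bjArg₁ δ ℓ‖ ^ 5 = 1 / ‖γ‖ ^ 4 := by
    rw [bjArg₁, norm_div, norm_neg, norm_bjOmega, norm_pow, ← hδ, norm_pow, div_pow, one_pow]
    ring
  rw [fcConverges_fifth_iff, h1, bjRadius_le_iff hpos.le, mul_one_div,
    div_le_one (by positivity)]

/-- With y = B(1/5;1/5;z), the functional equations give y⁵ = B(1/5;1;z) = 1 + z y; multiply by
(ωδ)⁵ = -δ⁵, where ω = `bjOmega ℓ`. -/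
theorem bjRoot₁_eq {δ : ℂ} (hδ : δ ≠ 0) {ℓ : ℕ}
    (h : FCConverges (1 / 5) (1 / 5) (bjArg₁ δ ℓ)) :
    bjRoot₁ δ ℓ ^ 5 - bjRoot₁ δ ℓ + δ ^ 5 = 0 := by
  have h5 := fcSeries_natCast_mul h 5
  have h1 := fcSeries_add_one (fcConverges_zero (1 / 5) (bjArg₁ δ ℓ))
    (by rw [zero_add]; exact h)
  rw [fcSeries_zero, zero_add, zero_add] at h1
  rw [show ((5 : ℕ) : ℂ) * (1 / 5) = 1 by norm_num, h1] at h5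
  rw [bjRoot₁, mul_pow, mul_pow, bjOmega_pow_five, ← h5]
  generalize fcSeries (1 / 5) (1 / 5) (bjArg₁ δ ℓ) = y
  rw [bjArg₁]
  field_simp
  ring

/-- If k + t = 5m, the factor with j = m is zero. Only for k = 4, t = 1 is the product empty, so
that m is out of range; this exception produces the power sum 4. -/
theorem fussCatalan_fifth_eq_zero {k t : ℕ} (hk : 1 ≤ k) (hk4 : k ≤ 4) (h : 5 ∣ k + t)
    (ht : ¬ (k = 4 ∧ t = 1)) : fussCatalan (1 / 5) (k * (1 / 5)) t = 0 := by
  obtain ⟨m, hm⟩ := h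
  rw [fussCatalan, if_neg (by omega)]
  refine mul_eq_zero_of_right _ (Finset.prod_eq_zero (i := m) ?_ ?_)
  · rw [Finset.mem_Icc]
    omega
  · have : (k : ℂ) + t = 5 * m := by exact_mod_cast hm
    linear_combination this / 5

theorem sum_bjRoot₁_pow {δ : ℂ} (hδ : δ ≠ 0)
    (h : ∀ ℓ < 5, FCConverges (1 / 5) (1 / 5) (bjArg₁ δ ℓ)) {k : ℕ} (hk : 1 ≤ k) (hk4 : k ≤ 4) :
    ∑ ℓ ∈ Finset.range 5, bjRoot₁ δ ℓ ^ k = if k = 4 then 4 else 0 := by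
  have h1 : HasSum (fun t => ∑ ℓ ∈ Finset.range 5, (bjOmega ℓ * δ) ^ k *
      (fussCatalan (1 / 5) (k * (1 / 5)) t * bjArg₁ δ ℓ ^ t))
      (∑ ℓ ∈ Finset.range 5, bjRoot₁ δ ℓ ^ k) := by
    refine hasSum_sum fun ℓ hℓ => ?_
    have hc := h ℓ (Finset.mem_range.mp hℓ)
    rw [bjRoot₁, mul_pow _ (fcSeries _ _ _), ← fcSeries_natCast_mul hc]
    exact (fcConverges_natCast_mul hc k).of_norm.hasSum.mul_left _
  have h2 : ∀ t, ∑ ℓ ∈ Finset.range 5, (bjOmega ℓ * δ) ^ k *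
      (fussCatalan (1 / 5) (k * (1 / 5)) t * bjArg₁ δ ℓ ^ t) =
      δ ^ k * fussCatalan (1 / 5) (k * (1 / 5)) t * (-1 / δ ^ 4) ^ t *
        ∑ ℓ ∈ Finset.range 5, bjOmega ℓ ^ (k + t) := by
    intro t
    rw [Finset.mul_sum]
    refine Finset.sum_congr rfl fun ℓ _ => ?_
    rw [bjArg₁, show -bjOmega ℓ / δ ^ 4 = bjOmega ℓ * (-1 / δ ^ 4) by ring, mul_pow, mul_pow,
      pow_add]
    ring
  simp only [h2] at h1
  refine h1.unique ?_
  have h3 : ∀ t, ¬ (k = 4 ∧ t = 1) → δ ^ k * fussCatalan (1 / 5) (k * (1 / 5)) t *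
      (-1 / δ ^ 4) ^ t * ∑ ℓ ∈ Finset.range 5, bjOmega ℓ ^ (k + t) = 0 := by
    intro t ht
    by_cases hd : 5 ∣ k + t
    · rw [fussCatalan_fifth_eq_zero hk hk4 hd ht]
      ring
    · rw [sum_bjOmega_pow hd, mul_zero]
  -- Only t = 1 can survive, and for k = 4 it gives δ⁴ · (4/5) · (-1/δ⁴) · (-5) = 4.
  have h4 := hasSum_single 1 fun t ht => h3 t fun h => ht h.2
  convert h4 using 1
  split_ifs with hk'
  · subst hk'
    simp only [show 4 + 1 = 5 from rfl, bjOmega_pow_five, fussCatalan_one]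
    simp
    field_simp
  · exact (h3 1 fun h => hk' h.1).symm

/-! ### From power sums to the multiset of roots. -/

/-- Newton's identities for five numbers whose first four power sums are those of the roots
of `X ^ 5 - X + C γ`. -/
theorem prod_X_sub_C_eq_bringJerrard {γ a b c d e : ℂ} (h1 : a + b + c + d + e = 0)
    (h2 : a ^ 2 + b ^ 2 + c ^ 2 + d ^ 2 + e ^ 2 = 0)
    (h3 : a ^ 3 + b ^ 3 + c ^ 3 + d ^ 3 + e ^ 3 = 0)
    (h4 : a ^ 4 + b ^ 4 + c ^ 4 + d ^ 4 + e ^ 4 = 4) (ha : a ^ 5 - a + γ = 0) :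
    (X - C a) * ((X - C b) * ((X - C c) * ((X - C d) * (X - C e)))) = bringJerrard γ := by
  have e2 : a * b + a * c + a * d + a * e + b * c + b * d + b * e + c * d + c * e + d * e = 0 := by
    linear_combination (a + b + c + d + e) / 2 * h1 - h2 / 2
  have e3 : a * b * c + a * b * d + a * b * e + a * c * d + a * c * e + a * d * e + b * c * d +
      b * c * e + b * d * e + c * d * e = 0 := by
    linear_combination ((a + b + c + d + e) ^ 2 -
      3 * (a ^ 2 + b ^ 2 + c ^ 2 + d ^ 2 + e ^ 2)) / 6 * h1 + h3 / 3
  have e4 : a * b * c * d + a * b * c * e + a * b * d * e + a * c * d * e + b * c * d * e = -1 := by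
    linear_combination ((a + b + c + d + e) ^ 3 -
      6 * (a + b + c + d + e) * (a ^ 2 + b ^ 2 + c ^ 2 + d ^ 2 + e ^ 2) +
      8 * (a ^ 3 + b ^ 3 + c ^ 3 + d ^ 3 + e ^ 3)) / 24 * h1 +
      (a ^ 2 + b ^ 2 + c ^ 2 + d ^ 2 + e ^ 2) / 8 * h2 - h4 / 4
  -- The constant term is read off from the quintic at its root `a`, so no fifth power sum is needed
  -- and only one of the numbers has to be a known root.
  have e5 : a * b * c * d * e = -γ := by
    linear_combination -a ^ 4 * h1 + a ^ 3 * e2 - a ^ 2 * e3 + a * e4 + ha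
  have key : (X - C a) * ((X - C b) * ((X - C c) * ((X - C d) * (X - C e)))) =
      X ^ 5 - C (a + b + c + d + e) * X ^ 4 +
      C (a * b + a * c + a * d + a * e + b * c + b * d + b * e + c * d + c * e + d * e) * X ^ 3 -
      C (a * b * c + a * b * d + a * b * e + a * c * d + a * c * e + a * d * e + b * c * d +
        b * c * e + b * d * e + c * d * e) * X ^ 2 +
      C (a * b * c * d + a * b * c * e + a * b * d * e + a * c * d * e + b * c * d * e) * X -
      C (a * b * c * d * e) := by
    simp only [C_add, C_mul]
    ring
  rw [key, h1, e2, e3, e4, e5, bringJerrard]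
  simp only [C_0, C_neg, C_1]
  ring

theorem roots_bringJerrard {γ a b c d e : ℂ} (h1 : a + b + c + d + e = 0)
    (h2 : a ^ 2 + b ^ 2 + c ^ 2 + d ^ 2 + e ^ 2 = 0)
    (h3 : a ^ 3 + b ^ 3 + c ^ 3 + d ^ 3 + e ^ 3 = 0)
    (h4 : a ^ 4 + b ^ 4 + c ^ 4 + d ^ 4 + e ^ 4 = 4) (ha : a ^ 5 - a + γ = 0) :
    (bringJerrard γ).roots = {a, b, c, d, e} := by
  rw [← prod_X_sub_C_eq_bringJerrard h1 h2 h3 h4 ha,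
    ← roots_multiset_prod_X_sub_C ({a, b, c, d, e} : Multiset ℂ)]
  simp

theorem roots_bringJerrard_eq_map_bjRoot₁ {γ δ : ℂ} (hγ : γ ≠ 0) (hδ : δ ^ 5 = γ)
    (h : bjRadius ≤ ‖γ‖) : (bringJerrard γ).roots = (Multiset.range 5).map (bjRoot₁ δ) := by
  have hδ0 : δ ≠ 0 := by
    rintro rfl
    exact hγ (by rw [← hδ]; norm_num)
  have hc : ∀ ℓ < 5, FCConverges (1 / 5) (1 / 5) (bjArg₁ δ ℓ) := fun ℓ _ =>
    (fcConverges_bjArg₁_iff hγ hδ ℓ).mpr h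
  -- The indices descend because `Multiset.range_succ` puts the largest first.
  have hs : ∀ k, 1 ≤ k → k ≤ 4 → bjRoot₁ δ 4 ^ k + bjRoot₁ δ 3 ^ k + bjRoot₁ δ 2 ^ k +
      bjRoot₁ δ 1 ^ k + bjRoot₁ δ 0 ^ k = if k = 4 then 4 else 0 := by
    intro k hk hk4
    rw [← sum_bjRoot₁_pow hδ0 hc hk hk4]
    simp only [Finset.sum_range_succ, Finset.sum_range_zero]
    ring
  rw [roots_bringJerrard (by simpa using hs 1) (by simpa using hs 2) (by simpa using hs 3)
    (by simpa using hs 4) (hδ ▸ bjRoot₁_eq hδ0 (hc 4 (by norm_num)))]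
  simp [Multiset.range_succ]

/-! ### The series with μ = 5 and μ = -1/4. -/

theorem exp_I_mul_pi_mul_div_two (ℓ : ℕ) :
    Complex.exp (Complex.I * Real.pi * (ℓ : ℂ) / 2) = Complex.I ^ ℓ := by
  rw [show Complex.I * Real.pi * (ℓ : ℂ) / 2 = ℓ * (Real.pi / 2 * Complex.I) by ring,
    Complex.exp_nat_mul, Complex.exp_pi_div_two_mul_I]

theorem bjArg₃_eq (γ : ℂ) (ℓ : ℕ) : bjArg₃ γ ℓ = (Complex.I ^ ℓ) ^ 3 * -γ := by
  have h : Complex.I ^ ℓ * (Complex.I ^ ℓ) ^ 3 = 1 := by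
    rw [← pow_succ', ← pow_mul, mul_comm, pow_mul, Complex.I_pow_four, one_pow]
  rw [bjArg₃, Complex.exp_neg, exp_I_mul_pi_mul_div_two, inv_eq_of_mul_eq_one_right h]
  ring

theorem bjRoot₃_eq_mul (γ : ℂ) (ℓ : ℕ) :
    bjRoot₃ γ ℓ = Complex.I ^ ℓ * fcSeries (-1 / 4) (1 / 4) (bjArg₃ γ ℓ) := by
  rw [bjRoot₃, exp_I_mul_pi_mul_div_two]

theorem norm_bjArg₃ (γ : ℂ) (ℓ : ℕ) : ‖bjArg₃ γ ℓ‖ = ‖γ‖ := by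
  rw [bjArg₃_eq]
  simp

theorem fcConverges_bjArg₃_iff (γ : ℂ) (ℓ : ℕ) :
    FCConverges (-1 / 4) (1 / 4) (bjArg₃ γ ℓ) ↔ ‖γ‖ ≤ bjRadius := by
  rw [fcConverges_neg_fourth_iff, norm_bjArg₃, le_bjRadius_iff (norm_nonneg _)]
  constructor <;> intro h <;> linarith

theorem fcConverges_five_pow_four_iff (γ : ℂ) : FCConverges 5 1 (γ ^ 4) ↔ ‖γ‖ ≤ bjRadius := by
  rw [fcConverges_five_iff, norm_pow, le_bjRadius_iff (norm_nonneg _)]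
  constructor <;> intro h <;> linarith

/-- B(5;1;z) = 1 + z B(5;5;z) = 1 + z B(5;1;z)⁵, taken at z = γ⁴ and multiplied by γ. -/
theorem bjRoot₂_eq {γ : ℂ} (h : FCConverges 5 1 (γ ^ 4)) :
    bjRoot₂ γ ^ 5 - bjRoot₂ γ + γ = 0 := by
  have h5 := fcSeries_natCast_mul h 5
  have h1 := fcSeries_add_one (fcConverges_zero 5 (γ ^ 4))
    (by rw [zero_add]; simpa using fcConverges_natCast_mul h 5)
  rw [fcSeries_zero, zero_add, zero_add] at h1
  rw [show ((5 : ℕ) : ℂ) * 1 = 5 by norm_num] at h5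
  rw [h5] at h1
  rw [bjRoot₂]
  linear_combination -γ * h1

theorem sum_I_pow {n : ℕ} (hn : ¬ 4 ∣ n) : ∑ ℓ ∈ Finset.range 4, (Complex.I ^ n) ^ ℓ = 0 := by
  refine sum_pow_eq_zero_of_pow_eq_one (fun h => hn ?_) ?_
  · exact (IsPrimitiveRoot.pow_eq_one_iff_dvd Complex.isPrimitiveRoot_I n).mp h
  · rw [← pow_mul, mul_comm, pow_mul, Complex.I_pow_four, one_pow]

theorem factorial_mul_prod_range_neg (m n : ℕ) :
    (m.factorial : ℂ) * ∏ i ∈ Finset.range n, (-(m : ℂ) - 1 - (i : ℂ)) =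
      (-1) ^ n * ((m + n).factorial : ℂ) := by
  induction n with
  | zero => simp
  | succ n ih =>
    rw [Finset.prod_range_succ, ← mul_assoc, ih, ← add_assoc, Nat.factorial_succ]
    push_cast
    ring

theorem factorial_mul_prod_range_add_sub (m n : ℕ) :
    (m.factorial : ℂ) * ∏ i ∈ Finset.range n, ((m : ℂ) + n - (i : ℂ)) =
      ((m + n).factorial : ℂ) := by
  induction n with
  | zero => simp
  | succ n ih =>
    have h := prod_range_add_one_sub ((m : ℂ) + n) n
    rw [Nat.cast_succ, ← add_assoc, h, ← add_assoc, Nat.factorial_succ, Nat.cast_mul, ← ih]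
    push_cast
    ring

/-- The coefficients with `μ = -1/4` in one residue class modulo four are, up to a factor, the
coefficients with `μ = 5`. -/
theorem fussCatalan_neg_fourth_eq {k : ℕ} (hk : 1 ≤ k) (m : ℕ) :
    4 * fussCatalan (-1 / 4) (k * (1 / 4)) (k + 4 * m) * (-1) ^ k = -fussCatalan 5 k m := by
  have hm : ∀ n : ℕ, (n.factorial : ℂ) ≠ 0 := fun n =>
    Nat.cast_ne_zero.mpr (Nat.factorial_ne_zero n)
  obtain ⟨j, rfl⟩ : ∃ j, k = j + 1 := ⟨k - 1, by omega⟩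
  have hs : (-1 : ℂ) ^ (j + 4 * m) * (-1) ^ (j + 1) = -1 := by
    rw [← pow_add, show j + 4 * m + (j + 1) = 2 * (j + 2 * m) + 1 by ring, pow_succ, pow_mul]
    norm_num
  -- At t = k + 4m the top tμ + r - 1 of the falling product is the integer -m - 1, so the product
  -- is a signed quotient of factorials.
  have h1 : fussCatalan (-1 / 4) ((j + 1 : ℕ) * (1 / 4)) (j + 1 + 4 * m) =
      ((j + 1 : ℕ) : ℂ) / 4 / ((j + 1 + 4 * m).factorial : ℂ) *
        ((-1) ^ (j + 4 * m) * ((m + (j + 4 * m)).factorial : ℂ) / (m.factorial : ℂ)) := by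
    rw [← factorial_mul_prod_range_neg, mul_div_cancel_left₀ _ (hm m),
      show j + 1 + 4 * m = j + 4 * m + 1 by ring, fussCatalan_succ]
    congr 1
    · ring
    · refine Finset.prod_congr rfl fun i _ => ?_
      push_cast
      ring
  have h2 : fussCatalan 5 (j + 1 : ℕ) m = ((j + 1 : ℕ) : ℂ) / (m.factorial : ℂ) *
      (((m + (j + 4 * m)).factorial : ℂ) / ((j + 1 + 4 * m).factorial : ℂ)) := by
    -- The value at m = 0 is set by convention, and the factorial formula has to be checked against
    -- it.
    cases m with
    | zero =>
      have hj : (j : ℂ) + 1 ≠ 0 := by exact_mod_cast Nat.succ_ne_zero j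
      have hj' := hm j
      simp [fussCatalan_zero, Nat.factorial_succ]
      field_simp
    | succ l =>
      rw [fussCatalan_succ, show l + 1 + (j + 4 * (l + 1)) = j + 1 + 4 * (l + 1) + l by ring,
        ← factorial_mul_prod_range_add_sub (j + 1 + 4 * (l + 1)) l, mul_div_cancel_left₀ _ (hm _)]
      congr 1
      refine Finset.prod_congr rfl fun i _ => ?_
      push_cast
      ring
  rw [h1, h2]
  have e1 := hm m
  have e2 := hm (j + 1 + 4 * m)
  field_simp
  linear_combination ((m + (j + 4 * m)).factorial : ℂ) * hs

/-- The sum over ℓ keeps the t with 4 ∣ k + 3t, that is t ≡ k mod 4. The terms t = k + 4m add up to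
minus the k-th power of γ B(5;1;γ⁴). -/
theorem sum_bjRoot₃_pow {γ : ℂ} (h : ‖γ‖ ≤ bjRadius) {k : ℕ} (hk : 1 ≤ k) (hk4 : k ≤ 4) :
    bjRoot₂ γ ^ k + ∑ ℓ ∈ Finset.range 4, bjRoot₃ γ ℓ ^ k = if k = 4 then 4 else 0 := by
  set F : ℕ → ℂ := fun t => fussCatalan (-1 / 4) (k * (1 / 4)) t * (-γ) ^ t *
    ∑ ℓ ∈ Finset.range 4, (Complex.I ^ (k + 3 * t)) ^ ℓ with hF
  have h1 : HasSum F (∑ ℓ ∈ Finset.range 4, bjRoot₃ γ ℓ ^ k) := by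
    have h2 : HasSum (fun t => ∑ ℓ ∈ Finset.range 4, (Complex.I ^ ℓ) ^ k *
        (fussCatalan (-1 / 4) (k * (1 / 4)) t * bjArg₃ γ ℓ ^ t))
        (∑ ℓ ∈ Finset.range 4, bjRoot₃ γ ℓ ^ k) := by
      refine hasSum_sum fun ℓ _ => ?_
      have hc := (fcConverges_bjArg₃_iff γ ℓ).mpr h
      rw [bjRoot₃_eq_mul, mul_pow _ (fcSeries _ _ _), ← fcSeries_natCast_mul hc]
      exact (fcConverges_natCast_mul hc k).of_norm.hasSum.mul_left _
    refine h2.congr_fun fun t => ?_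
    simp only [hF]
    rw [Finset.mul_sum]
    refine Finset.sum_congr rfl fun ℓ _ => ?_
    rw [bjArg₃_eq, mul_pow, ← pow_mul Complex.I (k + 3 * t) ℓ]
    ring
  have hF0 : F 0 = if k = 4 then 4 else 0 := by
    simp only [hF, fussCatalan_zero, pow_zero, one_mul, mul_zero, add_zero]
    split_ifs with hk'
    · subst hk'
      simp
    · exact sum_I_pow (by omega)
  -- The term t = 0 is split off: for k = 4 it lies in the surviving class without having the form k
  -- + 4m, and it contributes the 4.
  have h3 : HasSum (fun t => if t = 0 then 0 else F t)
      (∑ ℓ ∈ Finset.range 4, bjRoot₃ γ ℓ ^ k - F 0) :=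
    hasSum_ite_sub_hasSum h1 0
  have hinj : Function.Injective fun m : ℕ => k + 4 * m := fun m n hmn => by
    simp only at hmn
    omega
  have h4 := (hinj.hasSum_iff (f := fun t => if t = 0 then 0 else F t) fun t ht => ?_).mpr h3
  · have hc := (fcConverges_five_pow_four_iff γ).mpr h
    have h5 := ((fcConverges_natCast_mul hc k).of_norm.hasSum).mul_left (-γ ^ k)
    have h6 := h4.unique (h5.congr_fun fun m => ?_)
    · rw [bjRoot₂, mul_pow, ← fcSeries_natCast_mul hc, ← hF0, fcSeries]
      linear_combination h6
    · simp only [Function.comp_apply]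
      rw [if_neg (by omega), hF]
      have h7 : Complex.I ^ (k + 3 * (k + 4 * m)) = 1 := by
        rw [show k + 3 * (k + 4 * m) = 4 * (k + 3 * m) by ring, pow_mul, Complex.I_pow_four,
          one_pow]
      have h8 := fussCatalan_neg_fourth_eq hk m
      have h9 : (-γ) ^ (k + 4 * m) = (-1) ^ k * γ ^ k * (γ ^ 4) ^ m := by
        rw [pow_add, neg_pow γ k, pow_mul, neg_pow γ 4]
        norm_num
      simp only [h7, h9, mul_one, one_pow, Finset.sum_const, Finset.card_range, nsmul_eq_mul]
      push_cast
      linear_combination γ ^ k * (γ ^ 4) ^ m * h8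
  · split_ifs with ht0
    · rfl
    · simp only [hF]
      rw [sum_I_pow, mul_zero]
      intro hd
      refine ht ⟨(t - k) / 4, ?_⟩
      simp only
      omega

theorem roots_bringJerrard_eq_cons_map_bjRoot₃ {γ : ℂ} (h : ‖γ‖ ≤ bjRadius) :
    (bringJerrard γ).roots = bjRoot₂ γ ::ₘ (Multiset.range 4).map (bjRoot₃ γ) := by
  have hs : ∀ k, 1 ≤ k → k ≤ 4 → bjRoot₂ γ ^ k + bjRoot₃ γ 3 ^ k + bjRoot₃ γ 2 ^ k +
      bjRoot₃ γ 1 ^ k + bjRoot₃ γ 0 ^ k = if k = 4 then 4 else 0 := by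
    intro k hk hk4
    rw [← sum_bjRoot₃_pow h hk hk4]
    simp only [Finset.sum_range_succ, Finset.sum_range_zero]
    ring
  rw [roots_bringJerrard (by simpa using hs 1) (by simpa using hs 2) (by simpa using hs 3)
    (by simpa using hs 4) (bjRoot₂_eq ((fcConverges_five_pow_four_iff γ).mpr h))]
  simp [Multiset.range_succ]

/-! ### Double roots, limits as γ → 0, and the conclusion. -/

theorem bringJerrard_ne_zero (γ : ℂ) : bringJerrard γ ≠ 0 := by
  intro h
  have h1 := congrArg (eval 0) h
  have h2 := congrArg (eval 2) h
  simp [bringJerrard] at h1 h2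
  rw [h1] at h2
  norm_num at h2

theorem mem_roots_bringJerrard {γ x : ℂ} : x ∈ (bringJerrard γ).roots ↔ x ^ 5 - x + γ = 0 := by
  rw [mem_roots (bringJerrard_ne_zero γ), IsRoot.def]
  simp [bringJerrard]

/-- A double root also satisfies 5x⁴ = 1, whence γ = 4x/5 and |γ|⁴ = 256/3125. Below the critical
modulus two listed roots therefore cannot coincide. -/
theorem norm_eq_bjRadius_of_one_lt_count {γ x : ℂ} (h : 1 < (bringJerrard γ).roots.count x) :
    ‖γ‖ = bjRadius := by
  rw [count_roots, one_lt_rootMultiplicity_iff_isRoot (bringJerrard_ne_zero γ)] at h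
  obtain ⟨h1, h2⟩ := h
  simp [bringJerrard] at h1 h2
  have h3 : γ = 4 / 5 * x := by linear_combination h1 - x / 5 * h2
  have h4 : x ^ 4 = 1 / 5 := by linear_combination h2 / 5
  have h5 : ‖γ‖ ^ 4 = bjRadius ^ 4 := by
    rw [bjRadius_pow_four, ← norm_pow, h3, mul_pow, h4]
    norm_num
  exact (pow_left_inj₀ (norm_nonneg _) bjRadius_pos.le (by norm_num)).mp h5

theorem bjRoot₂_ne_bjRoot₃ {γ : ℂ} (h : ‖γ‖ < bjRadius) {ℓ : ℕ} (hℓ : ℓ < 4) :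
    bjRoot₂ γ ≠ bjRoot₃ γ ℓ := by
  intro heq
  refine h.ne (norm_eq_bjRadius_of_one_lt_count (x := bjRoot₂ γ) ?_)
  rw [roots_bringJerrard_eq_cons_map_bjRoot₃ h.le, Multiset.count_cons_self, Nat.lt_add_left_iff_pos,
    Multiset.count_pos, heq]
  exact Multiset.mem_map_of_mem _ (Multiset.mem_range.mpr hℓ)

/-- Absolute convergence at ρ dominates the series uniformly on the ball of radius ρ, which gives
continuity at 0. -/
theorem tendsto_fcSeries_zero {μ r : ℂ} {ρ : ℝ} (hρ : 0 < ρ) (h : FCConverges μ r ρ) :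
    Tendsto (fcSeries μ r) (𝓝 0) (𝓝 1) := by
  have hc : ContinuousOn (fcSeries μ r) (Metric.ball 0 ρ) := by
    refine continuousOn_tsum (fun t => by fun_prop) h fun t z hz => ?_
    rw [norm_mul, norm_mul, norm_pow, norm_pow, Complex.norm_real, Real.norm_of_nonneg hρ.le]
    exact mul_le_mul_of_nonneg_left
      (pow_le_pow_left₀ (norm_nonneg _) (mem_ball_zero_iff.mp hz).le t) (norm_nonneg _)
  have h0 : fcSeries μ r 0 = 1 := by
    rw [fcSeries, tsum_eq_single 0 fun t ht => by rw [zero_pow ht, mul_zero]]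
    simp [fussCatalan_zero]
  have := (hc.continuousAt (Metric.ball_mem_nhds 0 hρ)).tendsto
  rwa [h0] at this

theorem tendsto_bjRoot₂ : Tendsto bjRoot₂ (𝓝 0) (𝓝 0) := by
  have h1 : Tendsto (fcSeries 5 1) (𝓝 0) (𝓝 1) := by
    refine tendsto_fcSeries_zero (ρ := 1 / 100) (by norm_num) ?_
    rw [fcConverges_five_iff, Complex.norm_real]
    norm_num
  have h2 : Tendsto (fun γ : ℂ => γ ^ 4) (𝓝 0) (𝓝 0) := by
    simpa using (continuous_pow 4).tendsto (0 : ℂ)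
  have := (tendsto_id (α := ℂ) (x := 𝓝 0)).mul (h1.comp h2)
  rw [zero_mul] at this
  exact this

theorem tendsto_bjRoot₃ (ℓ : ℕ) : Tendsto (fun γ : ℂ => bjRoot₃ γ ℓ) (𝓝 0)
    (𝓝 (Complex.exp (Complex.I * Real.pi * (ℓ : ℂ) / 2))) := by
  have h1 : Tendsto (fcSeries (-1 / 4) (1 / 4)) (𝓝 0) (𝓝 1) := by
    refine tendsto_fcSeries_zero (ρ := 1 / 100) (by norm_num) ?_
    rw [fcConverges_neg_fourth_iff, Complex.norm_real]
    norm_num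
  have h2 : Tendsto (fun γ : ℂ => bjArg₃ γ ℓ) (𝓝 0) (𝓝 0) := by
    have : Continuous fun γ : ℂ => bjArg₃ γ ℓ := by
      unfold bjArg₃
      fun_prop
    simpa [bjArg₃] using this.tendsto 0
  have := (h1.comp h2).const_mul (Complex.exp (Complex.I * Real.pi * (ℓ : ℂ) / 2))
  rw [mul_one] at this
  exact this

theorem mainTheorem6 :
    -- the series with parameter 1/5: exact domain of convergence, and all five roots there
    (∀ γ δ : ℂ, γ ≠ 0 → δ ^ 5 = γ →
      (∀ ℓ < 5, (FCConverges (1 / 5) (1 / 5) (bjArg₁ δ ℓ) ↔ bjRadius ≤ ‖γ‖)) ∧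
      (bjRadius ≤ ‖γ‖ →
        (bringJerrard γ).roots = (Multiset.range 5).map (bjRoot₁ δ))) ∧
    -- the series with parameters 5 and -1/4: exact domain of convergence, and all five roots there
    (∀ γ : ℂ,
      (FCConverges 5 1 (γ ^ 4) ↔ ‖γ‖ ≤ bjRadius) ∧
      (∀ ℓ < 4, (FCConverges (-1 / 4) (1 / 4) (bjArg₃ γ ℓ) ↔ ‖γ‖ ≤ bjRadius)) ∧
      (‖γ‖ ≤ bjRadius →
        (bringJerrard γ).roots = bjRoot₂ γ ::ₘ (Multiset.range 4).map (bjRoot₃ γ)) ∧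
      (‖γ‖ < bjRadius → ∀ ℓ < 4, bjRoot₂ γ ≠ bjRoot₃ γ ℓ)) ∧
    -- the branches selected by the last two series
    Filter.Tendsto bjRoot₂ (nhds 0) (nhds 0) ∧
    (∀ ℓ < 4, Filter.Tendsto (fun γ : ℂ => bjRoot₃ γ ℓ) (nhds 0)
      (nhds (Complex.exp (Complex.I * Real.pi * (ℓ : ℂ) / 2)))) ∧
    -- for every coefficient, every root is the sum of a convergent series of the list
    (∀ γ x : ℂ, x ^ 5 - x + γ = 0 ↔
      (γ ≠ 0 ∧ ∃ δ : ℂ, δ ^ 5 = γ ∧ ∃ ℓ < 5,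
        FCConverges (1 / 5) (1 / 5) (bjArg₁ δ ℓ) ∧ x = bjRoot₁ δ ℓ) ∨
      (FCConverges 5 1 (γ ^ 4) ∧ x = bjRoot₂ γ) ∨
      (∃ ℓ < 4, FCConverges (-1 / 4) (1 / 4) (bjArg₃ γ ℓ) ∧ x = bjRoot₃ γ ℓ)) := by
  refine ⟨fun γ δ hγ hδ => ⟨fun ℓ _ => fcConverges_bjArg₁_iff hγ hδ ℓ,
      roots_bringJerrard_eq_map_bjRoot₁ hγ hδ⟩,
    fun γ => ⟨fcConverges_five_pow_four_iff γ, fun ℓ _ => fcConverges_bjArg₃_iff γ ℓ,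
      roots_bringJerrard_eq_cons_map_bjRoot₃, fun h ℓ hℓ => bjRoot₂_ne_bjRoot₃ h hℓ⟩,
    tendsto_bjRoot₂, fun ℓ _ => tendsto_bjRoot₃ ℓ, fun γ x => ?_⟩
  rw [← mem_roots_bringJerrard]
  constructor
  · intro hx
    -- The two closed regions cover the plane, as both families converge on the critical circle.
    rcases le_total ‖γ‖ bjRadius with h | h
    · right
      rw [roots_bringJerrard_eq_cons_map_bjRoot₃ h, Multiset.mem_cons, Multiset.mem_map] at hx
      rcases hx with rfl | ⟨ℓ, hℓ, rfl⟩
      · exact Or.inl ⟨(fcConverges_five_pow_four_iff γ).mpr h, rfl⟩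
      · exact Or.inr ⟨ℓ, Multiset.mem_range.mp hℓ, (fcConverges_bjArg₃_iff γ ℓ).mpr h, rfl⟩
    · left
      have hγ : γ ≠ 0 := norm_pos_iff.mp (bjRadius_pos.trans_le h)
      obtain ⟨δ, hδ⟩ := IsAlgClosed.exists_pow_nat_eq γ (n := 5) (by norm_num)
      rw [roots_bringJerrard_eq_map_bjRoot₁ hγ hδ h, Multiset.mem_map] at hx
      obtain ⟨ℓ, hℓ, rfl⟩ := hx
      exact ⟨hγ, δ, hδ, ℓ, Multiset.mem_range.mp hℓ, (fcConverges_bjArg₁_iff hγ hδ ℓ).mpr h, rfl⟩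
  · rintro (⟨hγ, δ, hδ, ℓ, hℓ, hc, rfl⟩ | ⟨hc, rfl⟩ | ⟨ℓ, hℓ, hc, rfl⟩)
    · rw [roots_bringJerrard_eq_map_bjRoot₁ hγ hδ ((fcConverges_bjArg₁_iff hγ hδ ℓ).mp hc)]
      exact Multiset.mem_map_of_mem _ (Multiset.mem_range.mpr hℓ)
    · rw [roots_bringJerrard_eq_cons_map_bjRoot₃ ((fcConverges_five_pow_four_iff γ).mp hc)]
      exact Multiset.mem_cons_self _ _
    · rw [roots_bringJerrard_eq_cons_map_bjRoot₃ ((fcConverges_bjArg₃_iff γ ℓ).mp hc)]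
      exact Multiset.mem_cons_of_mem (Multiset.mem_map_of_mem _ (Multiset.mem_range.mpr hℓ))
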